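/- Fix integers $d, H\ge 0$ and $\Delta\ge 1$ and a threshold $\theta\in\mathbb{R}$. For a differentiable $f:\mathbb{R}^d\to\mathbb{R}$, a point $x\in\mathbb{R}^d$ and a step size $\eta\ge 0$, gradient descent produces the iterates $x_1=x$, $x_{i+1}=x_i-\eta\nabla f(x_i)$. Its cost $\ell_\eta(x,f)$ is the number of iterations run, i.e. the least $i\in\{1,\dots,H\}$ with $\|\nabla f(x_i)\|<\theta$ if such an $i$ exists, and $H$ otherwise. Theorem. There is a universal constant $C>0$ such that the following holds for all $d,H,\Delta,\theta$ as above. Let $\Pi$ be any set of pairs $(x,f)$ in which $x\in\mathbb{R}^d$ and $f:\mathbb{R}^d\to\mathbb{R}$ is a polynomial function of total degree at most $\Delta$, let $\mathcal{P}\subseteq\mathbb{R}_{\ge 0}$ be any set of step sizes, and let $\mathcal{D}$ be any probability distribution over $\Pi$ (with the Borel $\sigma$-algebra of initial points and coefficients). Let $\epsilon>0$ and $\delta\in(0,1)$, and suppose that $\Delta\ge 2$ or $\delta\le 1/2$. Then for every integer $$m\ \ge\ C\,\frac{H^2}{\epsilon^2}\Bigl(H\log\Delta+\log\frac1\delta\Bigr),$$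 $(\epsilon,\delta)$-uniform convergence is achieved with $m$ samples: each $\ell_\eta$, $\eta\in\mathcal{P}$, is $\mathcal{D}$-integrable, and with probability at least $1-\delta$ over an i.i.d. sample $(z_1,\dots,z_m)\sim\mathcal{D}^m$, $$\Bigl|\frac1m\sum_{k=1}^m\ell_\eta(z_k)-\mathbb{E}_{z\sim\mathcal{D}}[\ell_\eta(z)]\Bigr|\le\epsilon\qquad\text{for all }\eta\in\mathcal{P}\text{ simultaneously}.$$ -/

import Mathlib

open MeasureTheory

/-- A polynomial function `ℝ^d → ℝ` of (total) degree at most `Δ`. -/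
def IsPolyOfDegreeLE (d Δ : ℕ) (f : EuclideanSpace ℝ (Fin d) → ℝ) : Prop :=
  ∃ p : MvPolynomial (Fin d) ℝ, p.totalDegree ≤ Δ ∧
    ∀ x : EuclideanSpace ℝ (Fin d), f x = MvPolynomial.eval (fun j => x j) p

/-- The iterates of gradient descent on `f` with step size `η` from the initial point `x`.
The value at `n` is the iterate `x_{n+1}`: `x_1 = x` and `x_{i+1} = x_i - η ∇f(x_i)`. -/
noncomputable def gdIterate {d : ℕ} (f : EuclideanSpace ℝ (Fin d) → ℝ) (η : ℝ)
    (x : EuclideanSpace ℝ (Fin d)) : ℕ → EuclideanSpace ℝ (Fin d)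
  | 0 => x
  | n + 1 => gdIterate f η x n - η • gradient f (gdIterate f η x n)

open Classical in
/-- The number of iterations for which gradient descent runs: the least `i ∈ {1, …, H}` with
`‖∇f(x_i)‖ < θ` if there is one, and `H` otherwise. (Below `n = i - 1`.) -/
noncomputable def gdCost {d : ℕ} (H : ℕ) (θ η : ℝ) (x : EuclideanSpace ℝ (Fin d))
    (f : EuclideanSpace ℝ (Fin d) → ℝ) : ℕ :=
  if h : ∃ n : ℕ, n < H ∧ ‖gradient f (gdIterate f η x n)‖ < θ then Nat.find h + 1 else H

/-- The class `{ℓ_η : η ∈ P}` of cost functions on the space `I` of instances `(x, f)`. -/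
def gdCostClass {d : ℕ} (H : ℕ) (θ : ℝ)
    (I : Set (EuclideanSpace ℝ (Fin d) × (EuclideanSpace ℝ (Fin d) → ℝ))) (P : Set ℝ) :
    Set (I → ℝ) :=
  {ℓ | ∃ η ∈ P, ℓ = fun z : I => (gdCost H θ η z.1.1 z.1.2 : ℝ)}

/-- `(ε, δ)`-uniform convergence with `m` samples for the function class `L` and the distribution
`D`: every function in `L` has an expectation, and with probability at least `1 - δ` over
`S ∼ D^m`, all functions in `L` have an empirical mean within `ε` of their expectation.
The failure event is bounded in outer measure, which is the strong reading in case that this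
event is not measurable. -/
def UniformConvergence {X : Type*} [MeasurableSpace X] (D : Measure X) [IsProbabilityMeasure D]
    (L : Set (X → ℝ)) (ε δ : ℝ) (m : ℕ) : Prop :=
  (∀ ℓ ∈ L, Integrable ℓ D) ∧
  Measure.pi (fun _ : Fin m => D)
    {S : Fin m → X | ¬ ∀ ℓ ∈ L, |(1 / (m : ℝ)) * ∑ k, ℓ (S k) - ∫ z, ℓ z ∂D| ≤ ε}
    ≤ ENNReal.ofReal δ

/-!
The class of costs has one real parameter, the step size `η`, and this is what makes it small. On a
fixed instance `(x, f)` the iterates are polynomials in `η`, so each `‖∇f(x_n)‖² - θ²` is one, of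
degree at most `2 (Δ - 1) Δ ^ n`. The cost can change only at the roots of these polynomials for
`n < H`, hence at no more than `K = 2 Δ ^ H` values of `η` (`exists_breakpoints`).

A uniform deviation of empirical means is symmetrized in the usual way
(`measure_exists_lt_abs_mean_sub_le`): it suffices to bound, for every fixed double sample, the
probability that a random exchange of the two halves makes the empirical means differ by `ε / 2` for
some `η`. A union bound over the `O(m K)` distinct behaviours on the sample would lose a factor
`log m`. Chaining avoids it (`card_exists_lt_abs_signedSum_le`). Counting the breakpoints of all
sample points passed so far gives a clock with values in `{0, …, 4 m K}`, and the vector of cost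
differences moves by a squared distance of at most `4 H²` per tick. The clock is cut into dyadic
cells, the coarsest of length about `m`. The `r`-th level has `O(K 2 ^ r)` cells, and the increments
from level to level have squared norm `O(H² m 2 ^ (-r))`, so thresholds decreasing like `(3 / 4) ^ r`
are summable while the failure probabilities still decay geometrically in `r`. The total is
`O(K) exp (-c m ε² / H²)`.

The parameter ranges over an uncountable set, so the symmetrized failure event is not obviously
measurable. Polynomial instances have finitely many measurable real coordinates, because a
finite-dimensional space of functions is determined by finitely many evaluations
(`exists_coordinates`). In these coordinates the event is the projection along `η` of a countable
union of closed sets in a Euclidean space, hence σ-compact and measurable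
(`measurableSet_exists_pattern`). The original failure event is only bounded in outer measure: each
of its points has a section of measure at least `1 / 2` in the measurable symmetrized event.
-/

/-! ### Rademacher sums -/

/-- The sign `±1` encoded by a Boolean. -/
noncomputable def boolSign (b : Bool) : ℝ := if b then 1 else -1

/-- The signed sum `∑ ± a k`. -/
noncomputable def signedSum {m : ℕ} (σ : Fin m → Bool) (a : Fin m → ℝ) : ℝ :=
  ∑ k, boolSign (σ k) * a k

lemma signedSum_sub {m : ℕ} (σ : Fin m → Bool) (a b : Fin m → ℝ) :
    signedSum σ (a - b) = signedSum σ a - signedSum σ b := by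
  simp [signedSum, mul_sub]

lemma signedSum_neg {m : ℕ} (σ : Fin m → Bool) (a : Fin m → ℝ) :
    signedSum σ (-a) = -signedSum σ a := by
  simp [signedSum]

lemma sum_exp_signedSum_le {m : ℕ} (a : Fin m → ℝ) :
    ∑ σ : Fin m → Bool, Real.exp (signedSum σ a) ≤ 2 ^ m * Real.exp ((∑ k, a k ^ 2) / 2) := by
  have h1 : ∑ σ : Fin m → Bool, Real.exp (signedSum σ a)
      = ∏ k, ∑ b : Bool, Real.exp (boolSign b * a k) := by
    rw [Finset.prod_univ_sum]
    rw [Fintype.piFinset_univ]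
    simp [signedSum, Real.exp_sum]
  rw [h1]
  have h2 : (2 : ℝ) ^ m * Real.exp ((∑ k, a k ^ 2) / 2)
      = ∏ k : Fin m, (2 * Real.exp (a k ^ 2 / 2)) := by
    rw [Finset.prod_mul_distrib, ← Real.exp_sum, Finset.sum_div]; simp
  rw [h2]
  refine Finset.prod_le_prod (fun k _ => Finset.sum_nonneg fun b _ => (Real.exp_pos _).le) ?_
  intro k _
  have := Real.cosh_le_exp_half_sq (a k)
  rw [Real.cosh_eq] at this
  simp [boolSign]
  linarith

lemma card_le_signedSum_le {m : ℕ} (a : Fin m → ℝ) {V τ : ℝ} (hV : 0 < V) (hτ : 0 ≤ τ)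
    (ha : ∑ k, a k ^ 2 ≤ V) :
    ((Finset.univ.filter fun σ : Fin m → Bool => τ ≤ signedSum σ a).card : ℝ)
      ≤ 2 ^ m * Real.exp (-(τ ^ 2 / (2 * V))) := by
  -- Chernoff bound with the optimal exponent `l = τ / V`
  set l := τ / V with hl
  have hl0 : 0 ≤ l := by positivity
  have h1 := sum_exp_signedSum_le (fun k => l * a k)
  have h2 : ∀ σ : Fin m → Bool, signedSum σ (fun k => l * a k) = l * signedSum σ a := by
    intro σ
    simp only [signedSum, Finset.mul_sum]
    exact Finset.sum_congr rfl fun k _ => by ring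
  have h3 : ((Finset.univ.filter fun σ : Fin m → Bool => τ ≤ signedSum σ a).card : ℝ)
      * Real.exp (l * τ) ≤ ∑ σ : Fin m → Bool, Real.exp (signedSum σ (fun k => l * a k)) := by
    rw [← nsmul_eq_mul]
    refine (Finset.card_nsmul_le_sum _ _ _ ?_).trans
      (Finset.sum_le_sum_of_subset_of_nonneg (Finset.filter_subset _ _)
        fun _ _ _ => (Real.exp_pos _).le)
    intro σ hσ
    rw [h2]
    have := (Finset.mem_filter.1 hσ).2
    gcongr
  have h4 : (∑ k, (l * a k) ^ 2) / 2 ≤ l ^ 2 * V / 2 := by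
    simp_rw [mul_pow]
    rw [← Finset.mul_sum]
    gcongr
  have h5 := (h3.trans h1).trans
    (mul_le_mul_of_nonneg_left (Real.exp_le_exp.2 h4) (by positivity : (0 : ℝ) ≤ 2 ^ m))
  rw [← le_div_iff₀ (Real.exp_pos _), mul_div_assoc, ← Real.exp_sub] at h5
  refine h5.trans (le_of_eq ?_)
  congr 2
  rw [hl]; field_simp; ring

lemma card_le_abs_signedSum_le {m : ℕ} (a : Fin m → ℝ) {V τ : ℝ} (hV : 0 < V) (hτ : 0 ≤ τ)
    (ha : ∑ k, a k ^ 2 ≤ V) :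
    ((Finset.univ.filter fun σ : Fin m → Bool => τ ≤ |signedSum σ a|).card : ℝ)
      ≤ 2 * 2 ^ m * Real.exp (-(τ ^ 2 / (2 * V))) := by
  have h1 := card_le_signedSum_le a hV hτ ha
  have h2 := card_le_signedSum_le (-a) hV hτ (by simpa using ha)
  have h3 : (Finset.univ.filter fun σ : Fin m → Bool => τ ≤ |signedSum σ a|) ⊆
      (Finset.univ.filter fun σ : Fin m → Bool => τ ≤ signedSum σ a) ∪
      (Finset.univ.filter fun σ : Fin m → Bool => τ ≤ signedSum σ (-a)) := by
    intro σ hσ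
    simp only [Finset.mem_filter, Finset.mem_univ, true_and, Finset.mem_union,
      signedSum_neg] at hσ ⊢
    exact le_abs.1 hσ
  have h4 : ((Finset.univ.filter fun σ : Fin m → Bool => τ ≤ |signedSum σ a|).card : ℝ) ≤
      (Finset.univ.filter fun σ : Fin m → Bool => τ ≤ signedSum σ a).card +
      (Finset.univ.filter fun σ : Fin m → Bool => τ ≤ signedSum σ (-a)).card := by
    exact_mod_cast (Finset.card_le_card h3).trans (Finset.card_union_le _ _)
  linarith

/-! ### Chaining along a clock -/

section Chaining

variable {T : Type*} [Nonempty T] (w : T → ℕ) (R : ℕ)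

open Classical in
/-- A parameter whose clock value `w t` lies in the `c`-th dyadic cell of length `2 ^ (R - r)`
(an arbitrary parameter if there is none). -/
noncomputable def cellRep (r c : ℕ) : T :=
  if h : ∃ t, w t / 2 ^ (R - r) = c then h.choose else Classical.arbitrary T

lemma cellRep_spec {r c : ℕ} (h : ∃ t, w t / 2 ^ (R - r) = c) :
    w (cellRep w R r c) / 2 ^ (R - r) = c := by
  rw [cellRep, dif_pos h]
  exact h.choose_spec

/-- The increment of the chain from level `r - 1` to level `r` in the `c`-th cell of level `r`;
at level `0` it is the vector of the representative itself. -/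
noncomputable def chainLink {m : ℕ} (v : T → Fin m → ℝ) : ℕ → ℕ → Fin m → ℝ
  | 0, c => v (cellRep w R 0 c)
  | r + 1, c => v (cellRep w R (r + 1) c) - v (cellRep w R r (c / 2))

lemma abs_sub_le_of_div_eq {a b q : ℕ} (hq : 0 < q) (h : a / q = b / q) :
    |(a : ℝ) - b| ≤ q := by
  have ha := Nat.div_add_mod a q
  have hb := Nat.div_add_mod b q
  have ha' := Nat.mod_lt a hq
  have hb' := Nat.mod_lt b hq
  rw [h] at ha
  have h1 : a ≤ b + q := by omega
  have h2 : b ≤ a + q := by omega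
  rw [abs_le]
  have h1' : (a : ℝ) ≤ b + q := by exact_mod_cast h1
  have h2' : (b : ℝ) ≤ a + q := by exact_mod_cast h2
  constructor <;> linarith

lemma div_two_pow_succ_level {r : ℕ} (hr : r + 1 ≤ R) (n : ℕ) :
    n / 2 ^ (R - (r + 1)) / 2 = n / 2 ^ (R - r) := by
  rw [Nat.div_div_eq_div_mul, ← pow_succ]
  congr 2
  omega

/-- The two representatives joined by a link lie in the same cell of the coarser level, so the clock
values differ by at most `2 ^ (R - r + 1) ≤ 2 m / 2 ^ r`. -/
lemma sum_chainLink_sq_le {m : ℕ} (v : T → Fin m → ℝ) {A : ℝ} (hA : 0 < A) (hR : 2 ^ R ≤ m)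
    (hv : ∀ s t, ∑ k, (v s k - v t k) ^ 2 ≤ A * |(w s : ℝ) - w t|)
    (hv0 : ∀ t, ∑ k, v t k ^ 2 ≤ A * m) {r c : ℕ} (hr : r ≤ R)
    (hc : ∃ t, w t / 2 ^ (R - r) = c) :
    ∑ k, chainLink w R v r c k ^ 2 ≤ 2 * A * m / 2 ^ r := by
  cases r with
  | zero =>
    have h := hv0 (cellRep w R 0 c)
    simp only [chainLink, pow_zero, div_one]
    have : 0 ≤ A * m := by positivity
    linarith
  | succ r =>
    obtain ⟨t, ht⟩ := hc
    have h1 : w (cellRep w R (r + 1) c) / 2 ^ (R - r) = c / 2 := by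
      rw [← div_two_pow_succ_level R hr, cellRep_spec w R ⟨t, ht⟩]
    have h2 : w (cellRep w R r (c / 2)) / 2 ^ (R - r) = c / 2 :=
      cellRep_spec w R ⟨t, by rw [← div_two_pow_succ_level R hr, ht]⟩
    have h3 := abs_sub_le_of_div_eq (q := 2 ^ (R - r)) (by positivity) (h1.trans h2.symm)
    refine (hv (cellRep w R (r + 1) c) (cellRep w R r (c / 2))).trans ?_
    have h4 : ((2 ^ (R - r) : ℕ) : ℝ) * 2 ^ r ≤ m := by
      have : 2 ^ (R - r) * 2 ^ r ≤ m := by rw [← pow_add, Nat.sub_add_cancel (by omega)]; exact hR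
      exact_mod_cast this
    rw [le_div_iff₀ (by positivity), pow_succ]
    calc A * |(w (cellRep w R (r + 1) c) : ℝ) - w (cellRep w R r (c / 2))| * (2 ^ r * 2)
        ≤ A * ((2 ^ (R - r) : ℕ) : ℝ) * (2 ^ r * 2) := by gcongr
      _ = 2 * A * (((2 ^ (R - r) : ℕ) : ℝ) * 2 ^ r) := by ring
      _ ≤ 2 * A * m := by gcongr

/-- Telescoping along the chain of representatives of the cells that contain `w t`. -/
lemma abs_signedSum_cellRep_le {m : ℕ} (v : T → Fin m → ℝ) (σ : Fin m → Bool) (b : ℕ → ℝ) (t : T)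
    (h : ∀ r ≤ R, |signedSum σ (chainLink w R v r (w t / 2 ^ (R - r)))| ≤ b r) {r : ℕ}
    (hr : r ≤ R) :
    |signedSum σ (v (cellRep w R r (w t / 2 ^ (R - r))))| ≤ ∑ i ∈ Finset.range (r + 1), b i := by
  induction r with
  | zero => simpa [chainLink] using h 0 hr
  | succ r ih =>
    have h1 := ih (by omega)
    have h2 := h (r + 1) hr
    rw [chainLink, signedSum_sub, div_two_pow_succ_level R hr] at h2
    rw [Finset.sum_range_succ]
    have h3 := abs_add_le (signedSum σ (v (cellRep w R r (w t / 2 ^ (R - r)))))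
      (signedSum σ (v (cellRep w R (r + 1) (w t / 2 ^ (R - (r + 1))))) -
        signedSum σ (v (cellRep w R r (w t / 2 ^ (R - r)))))
    rw [add_sub_cancel] at h3
    linarith

/-- The failure probability of one link decays like `4 ^ (-r)`, fast enough to pay for the `2 ^ r`
cells of its level: the threshold `(3 / 4) ^ r / 4` and the variance `2 ^ (-r)` give the exponent
`(9 / 8) ^ r x / 64`, which Bernoulli's inequality bounds below by `(1 + r / 8) x / 64`. -/
lemma exp_link_le {x : ℝ} (hx : 512 * Real.log 4 ≤ x) (r : ℕ) :
    Real.exp (-(x * ((3 / 4) ^ r / 4) ^ 2 * 2 ^ r / 4)) ≤ Real.exp (-(x / 64)) * (1 / 4) ^ r := by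
  have h1 : ((1 : ℝ) / 4) ^ r = Real.exp (-(r * Real.log 4)) := by
    rw [Real.exp_neg, Real.exp_nat_mul, Real.exp_log (by norm_num)]; simp
  rw [h1, ← Real.exp_add, Real.exp_le_exp]
  have h2 : ((3 / 4 : ℝ) ^ r / 4) ^ 2 * 2 ^ r = (1 + 1 / 8) ^ r / 16 := by
    rw [div_pow, ← pow_mul, mul_comm r 2, pow_mul, div_mul_eq_mul_div, ← mul_pow]; norm_num
  have h3 := one_add_mul_le_pow (show (-2 : ℝ) ≤ 1 / 8 by norm_num) r
  have h4 : 0 ≤ Real.log 4 := Real.log_nonneg (by norm_num)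
  have h5 : x * ((3 / 4) ^ r / 4) ^ 2 * 2 ^ r / 4 = x * ((1 + 1 / 8) ^ r / 64) := by
    rw [mul_assoc, h2]; ring
  rw [h5]
  have h6 : x * ((1 + r * (1 / 8)) / 64) ≤ x * ((1 + 1 / 8) ^ r / 64) := by
    gcongr
    linarith
  have h7 : (r : ℝ) * (512 * Real.log 4) ≤ r * x := by gcongr
  linarith

/-- The chaining bound: if the squared distance of `v s` and `v t` is controlled by the elapsed
clock time `|w s - w t|`, then the supremum over `t` of the Rademacher sums `∑ ± v t k` has the
tail of a single one, at the cost of a factor linear in `K` but without any logarithm of `m`. -/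
theorem card_exists_lt_abs_signedSum_le {m : ℕ} (hm : 0 < m) (v : T → Fin m → ℝ) {K : ℕ}
    (hK : 1 ≤ K) (hW : ∀ t, w t ≤ 4 * m * K) {A : ℝ} (hA : 0 < A)
    (hv : ∀ s t, ∑ k, (v s k - v t k) ^ 2 ≤ A * |(w s : ℝ) - w t|)
    (hv0 : ∀ t, ∑ k, v t k ^ 2 ≤ A * m) {τ : ℝ} (hτ : 0 ≤ τ)
    (hu : 512 * Real.log 4 ≤ τ ^ 2 / (A * m)) [DecidablePred fun σ : Fin m → Bool =>
      ∃ t, τ < |signedSum σ (v t)|] :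
    ((Finset.univ.filter fun σ : Fin m → Bool => ∃ t, τ < |signedSum σ (v t)|).card : ℝ)
      ≤ 2 ^ m * (36 * K * Real.exp (-(τ ^ 2 / (A * m) / 64))) := by
  classical
  -- the coarsest cells have length comparable to `m`, so that there are `O(K)` of them
  obtain ⟨R, hR1, hR2⟩ : ∃ R, 2 ^ R ≤ m ∧ m < 2 ^ (R + 1) :=
    ⟨Nat.log 2 m, Nat.pow_log_le_self 2 hm.ne', Nat.lt_pow_succ_log_self (by norm_num) m⟩
  have hm' : (0 : ℝ) < m := by exact_mod_cast hm
  -- the thresholds of the levels sum to at most `τ`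
  let b : ℕ → ℝ := fun r => τ * ((3 / 4) ^ r / 4)
  have hb : ∀ r, 0 ≤ b r := fun r => by positivity
  have hbsum : ∀ n, ∑ i ∈ Finset.range n, b i ≤ τ := by
    intro n
    rw [← Finset.mul_sum, ← Finset.sum_div, geom_sum_eq (by norm_num)]
    have : (0 : ℝ) ≤ (3 / 4) ^ n := by positivity
    calc τ * (((3 / 4) ^ n - 1) / (3 / 4 - 1) / 4) = τ * (1 - (3 / 4) ^ n) := by ring
      _ ≤ τ * 1 := by gcongr; linarith
      _ = τ := mul_one τ
  let occ : ℕ → Finset ℕ := fun r =>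
    (Finset.range (4 * m * K / 2 ^ (R - r) + 1)).filter fun c => ∃ t, w t / 2 ^ (R - r) = c
  have hocc : ∀ r ≤ R, ((occ r).card : ℝ) ≤ 9 * K * 2 ^ r := by
    intro r hr
    have h1 : (occ r).card ≤ 4 * m * K / 2 ^ (R - r) + 1 := by
      refine (Finset.card_filter_le _ _).trans ?_
      rw [Finset.card_range]
    have h2 : 4 * m * K / 2 ^ (R - r) ≤ 8 * K * 2 ^ r := by
      apply Nat.div_le_of_le_mul
      have h3 : 2 ^ (R - r) * (8 * K * 2 ^ r) = 4 * K * 2 ^ (R + 1) := by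
        have : 2 ^ R = 2 ^ (R - r) * 2 ^ r := by rw [← pow_add, Nat.sub_add_cancel hr]
        rw [pow_succ, this]; ring
      rw [h3]
      nlinarith
    have h4 : 1 ≤ K * 2 ^ r := Nat.one_le_iff_ne_zero.2 (by positivity)
    have h5 : (occ r).card ≤ 9 * K * 2 ^ r := by nlinarith
    exact_mod_cast h5
  have hsub : (Finset.univ.filter fun σ : Fin m → Bool => ∃ t, τ < |signedSum σ (v t)|) ⊆
      (Finset.range (R + 1)).biUnion fun r => (occ r).biUnion fun c =>
        Finset.univ.filter fun σ : Fin m → Bool => b r ≤ |signedSum σ (chainLink w R v r c)| := by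
    intro σ hσ
    simp only [Finset.mem_filter, Finset.mem_univ, true_and] at hσ
    obtain ⟨t, ht⟩ := hσ
    by_contra hcon
    simp only [Finset.mem_biUnion, Finset.mem_filter, Finset.mem_univ, true_and, not_exists,
      not_and, not_le, Finset.mem_range, Nat.lt_succ_iff] at hcon
    have h1 := abs_signedSum_cellRep_le w R v σ b t (fun r hr => (hcon r hr _ (by
      simp only [occ, Finset.mem_filter, Finset.mem_range, Nat.lt_succ_iff]
      exact ⟨Nat.div_le_div_right (hW t), t, rfl⟩)).le) le_rfl
    -- at the last level the cells are singletons, so the representative has the same vector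
    have h2 : v (cellRep w R R (w t / 2 ^ (R - R))) = v t := by
      have h3 := cellRep_spec w R (r := R) ⟨t, rfl⟩
      have h4 := hv (cellRep w R R (w t / 2 ^ (R - R))) t
      simp only [Nat.sub_self, pow_zero, Nat.div_one] at h3 h4 ⊢
      rw [h3, sub_self, abs_zero, mul_zero] at h4
      funext k
      have h5 := (Finset.sum_eq_zero_iff_of_nonneg (fun k _ => sq_nonneg _)).1
        (le_antisymm h4 (Finset.sum_nonneg fun k _ => sq_nonneg _)) k (Finset.mem_univ k)
      exact sub_eq_zero.1 (pow_eq_zero_iff (two_ne_zero) |>.1 h5)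
    rw [h2] at h1
    linarith [hbsum (R + 1)]
  have hcard : ((Finset.univ.filter fun σ : Fin m → Bool =>
      ∃ t, τ < |signedSum σ (v t)|).card : ℝ) ≤ ∑ r ∈ Finset.range (R + 1), ∑ c ∈ occ r,
        ((Finset.univ.filter fun σ : Fin m → Bool =>
          b r ≤ |signedSum σ (chainLink w R v r c)|).card : ℝ) := by
    have h1 := (Finset.card_le_card hsub).trans (Finset.card_biUnion_le.trans
      (Finset.sum_le_sum fun r _ => Finset.card_biUnion_le))
    exact_mod_cast h1
  refine hcard.trans ?_
  set x := τ ^ 2 / (A * m) with hx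
  have hlevel : ∀ r ∈ Finset.range (R + 1), ∑ c ∈ occ r,
      ((Finset.univ.filter fun σ : Fin m → Bool =>
          b r ≤ |signedSum σ (chainLink w R v r c)|).card : ℝ)
      ≤ 2 ^ m * (18 * K * Real.exp (-(x / 64))) * (1 / 2) ^ r := by
    intro r hr
    have hr' : r ≤ R := Nat.lt_succ_iff.1 (Finset.mem_range.1 hr)
    have h1 : ∀ c ∈ occ r, ((Finset.univ.filter fun σ : Fin m → Bool =>
          b r ≤ |signedSum σ (chainLink w R v r c)|).card : ℝ) ≤
          2 * 2 ^ m * (Real.exp (-(x / 64)) * (1 / 4) ^ r) := by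
      intro c hc
      have h2 := card_le_abs_signedSum_le (chainLink w R v r c) (V := 2 * A * m / 2 ^ r)
        (by positivity) (hb r) (sum_chainLink_sq_le w R v hA hR1 hv hv0 hr'
          (Finset.mem_filter.1 hc).2)
      refine h2.trans (mul_le_mul_of_nonneg_left ?_ (by positivity))
      refine le_trans (le_of_eq ?_) (exp_link_le hu r)
      congr 2
      simp only [b, hx]
      field_simp
      ring
    refine (Finset.sum_le_card_nsmul _ _ _ h1).trans ?_
    rw [nsmul_eq_mul]
    refine (mul_le_mul_of_nonneg_right (hocc r hr') (by positivity)).trans (le_of_eq ?_)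
    have h3 : (2 : ℝ) ^ r * (1 / 4) ^ r = (1 / 2) ^ r := by rw [← mul_pow]; norm_num
    rw [← h3]; ring
  refine (Finset.sum_le_sum hlevel).trans ?_
  rw [← Finset.mul_sum]
  have hgeom : ∑ i ∈ Finset.range (R + 1), ((1 : ℝ) / 2) ^ i ≤ 2 := by
    rw [geom_sum_eq (by norm_num)]
    have h1 : (0 : ℝ) ≤ (1 / 2) ^ (R + 1) := by positivity
    calc (((1 : ℝ) / 2) ^ (R + 1) - 1) / (1 / 2 - 1) = 2 - 2 * (1 / 2) ^ (R + 1) := by ring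
      _ ≤ 2 := by linarith
  refine (mul_le_mul_of_nonneg_left hgeom (by positivity)).trans (le_of_eq ?_)
  ring

end Chaining

/-! ### Gradients of polynomial functions -/

section PolynomialGradient

variable {d : ℕ}

lemma hasFDerivAt_eval_mvPolynomial (p : MvPolynomial (Fin d) ℝ) (x : EuclideanSpace ℝ (Fin d)) :
    HasFDerivAt (fun y : EuclideanSpace ℝ (Fin d) => MvPolynomial.eval (fun j => y j) p)
      (∑ j, MvPolynomial.eval (fun j => x j) (MvPolynomial.pderiv j p) •
        (EuclideanSpace.proj j : EuclideanSpace ℝ (Fin d) →L[ℝ] ℝ)) x := by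
  induction p using MvPolynomial.induction_on with
  | C a => simpa using hasFDerivAt_const a x
  | add p q hp hq =>
    simp only [map_add]
    refine (hp.add hq).congr_fderiv ?_
    simp [add_smul, Finset.sum_add_distrib]
  | mul_X p i hp =>
    simp only [map_mul, MvPolynomial.eval_X]
    have hi := (EuclideanSpace.proj (𝕜 := ℝ) i :
      EuclideanSpace ℝ (Fin d) →L[ℝ] ℝ).hasFDerivAt (x := x)
    refine (hp.mul hi).congr_fderiv ?_
    ext v
    simp [MvPolynomial.pderiv_X, Pi.single_apply, add_mul, Finset.sum_add_distrib,
      Finset.mul_sum]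
    congr 1
    · rw [Finset.sum_eq_single i (fun b _ hb => by simp [hb.symm]) (by simp)]
      simp
    · exact Finset.sum_congr rfl fun _ _ => by ring

lemma gradient_eval_mvPolynomial (p : MvPolynomial (Fin d) ℝ) (x : EuclideanSpace ℝ (Fin d))
    (j : Fin d) :
    gradient (fun y : EuclideanSpace ℝ (Fin d) => MvPolynomial.eval (fun j => y j) p) x j
      = MvPolynomial.eval (fun j => x j) (MvPolynomial.pderiv j p) := by
  have h := inner_gradient_right (𝕜 := ℝ)
    (f := fun y : EuclideanSpace ℝ (Fin d) => MvPolynomial.eval (fun j => y j) p)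
    (x := EuclideanSpace.single j (1 : ℝ)) (y := x)
  rw [(hasFDerivAt_eval_mvPolynomial p x).fderiv] at h
  rw [EuclideanSpace.inner_single_left] at h
  simpa using h

lemma totalDegree_pderiv_le (p : MvPolynomial (Fin d) ℝ) (j : Fin d) :
    (MvPolynomial.pderiv j p).totalDegree ≤ p.totalDegree - 1 := by
  refine Finset.sup_le fun s hs => ?_
  have h1 : s + Finsupp.single j 1 ∈ p.support := by
    rw [MvPolynomial.mem_support_iff] at hs ⊢
    intro h
    exact hs (by rw [MvPolynomial.coeff_pderiv, h, zero_mul])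
  have h2 := MvPolynomial.le_totalDegree h1
  rw [Finsupp.sum_add_index' (by simp) (by simp)] at h2
  simp at h2
  simp only [Finsupp.sum] at h2 ⊢
  omega

lemma eval_aeval_polynomial (p : MvPolynomial (Fin d) ℝ) (X : Fin d → Polynomial ℝ) (η : ℝ) :
    (MvPolynomial.aeval X p).eval η = MvPolynomial.eval (fun j => (X j).eval η) p := by
  induction p using MvPolynomial.induction_on with
  | C a => simp
  | add p q hp hq => simp [hp, hq]
  | mul_X p i hp => simp [hp]

end PolynomialGradient

/-! ### Dependence of the cost on the step size -/

open Classical in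
/-- One plus the least `n < H` with `p n`, or `H` if there is none. -/
noncomputable def firstHit (H : ℕ) (p : ℕ → Prop) : ℕ :=
  if h : ∃ n : ℕ, n < H ∧ p n then Nat.find h + 1 else H

lemma gdCost_eq_firstHit {d : ℕ} (H : ℕ) (θ η : ℝ) (x : EuclideanSpace ℝ (Fin d))
    (f : EuclideanSpace ℝ (Fin d) → ℝ) :
    gdCost H θ η x f = firstHit H fun n => ‖gradient f (gdIterate f η x n)‖ < θ := rfl

lemma firstHit_congr {H : ℕ} {p q : ℕ → Prop} (h : ∀ n < H, (p n ↔ q n)) :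
    firstHit H p = firstHit H q := by
  have h' : (fun n => n < H ∧ p n) = fun n => n < H ∧ q n := by
    funext n
    exact propext ⟨fun ⟨a, b⟩ => ⟨a, (h n a).1 b⟩, fun ⟨a, b⟩ => ⟨a, (h n a).2 b⟩⟩
  have key : ∀ P Q : ℕ → Prop, P = Q → ∀ (_ : DecidablePred P) (_ : DecidablePred Q)
      (hP : ∃ n, P n) (hQ : ∃ n, Q n), Nat.find hP = Nat.find hQ := by
    rintro P _ rfl _ _ hP hQ
    congr!
  unfold firstHit
  by_cases hp : ∃ n, n < H ∧ p n
  · have hq : ∃ n, n < H ∧ q n := by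
      obtain ⟨n, hn⟩ := hp
      exact ⟨n, (congrFun h' n).mp hn⟩
    rw [dif_pos hp, dif_pos hq, key _ _ h' _ _ hp hq]
  · have hq : ¬ ∃ n, n < H ∧ q n := by
      rintro ⟨n, hn⟩
      exact hp ⟨n, (congrFun h' n).mpr hn⟩
    rw [dif_neg hp, dif_neg hq]

lemma firstHit_le (H : ℕ) (p : ℕ → Prop) : firstHit H p ≤ H := by
  classical
  unfold firstHit
  split_ifs with h
  · exact (Nat.find_spec h).1
  · exact le_rfl

section Breakpoints

variable {d Δ : ℕ} {f : EuclideanSpace ℝ (Fin d) → ℝ}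

lemma exists_polynomial_gdIterate (hΔ : 1 ≤ Δ) {p : MvPolynomial (Fin d) ℝ}
    (hp : p.totalDegree ≤ Δ) (x : EuclideanSpace ℝ (Fin d)) (n : ℕ) :
    ∃ X : Fin d → Polynomial ℝ, (∀ j, (X j).natDegree ≤ Δ ^ n) ∧ ∀ η j,
      gdIterate (fun y : EuclideanSpace ℝ (Fin d) => MvPolynomial.eval (fun j => y j) p) η x n j
        = (X j).eval η := by
  induction n with
  | zero => exact ⟨fun j => Polynomial.C (x j), by simp, by simp [gdIterate]⟩
  | succ n ih =>
    obtain ⟨X, hX, hX'⟩ := ih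
    refine ⟨fun j => X j - Polynomial.X * MvPolynomial.aeval X (MvPolynomial.pderiv j p), ?_, ?_⟩
    · intro j
      have h1 : (MvPolynomial.aeval X (MvPolynomial.pderiv j p)).natDegree ≤ (Δ - 1) * Δ ^ n :=
        MvPolynomial.aeval_natDegree_le _ ((totalDegree_pderiv_le p j).trans (by omega)) X hX
      have h2 : 1 ≤ Δ ^ n := Nat.one_le_pow _ _ hΔ
      have h3 : Δ ^ (n + 1) = (Δ - 1) * Δ ^ n + Δ ^ n := by
        obtain ⟨e, rfl⟩ := Nat.exists_eq_add_of_le' hΔ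
        rw [pow_succ]; simp; ring
      refine (Polynomial.natDegree_sub_le _ _).trans (max_le ?_ ?_)
      · exact (hX j).trans (by omega)
      · refine Polynomial.natDegree_mul_le.trans ?_
        rw [Polynomial.natDegree_X]
        omega
    · intro η j
      rw [gdIterate, PiLp.sub_apply, PiLp.smul_apply, gradient_eval_mvPolynomial, hX']
      simp [hX', eval_aeval_polynomial]

lemma exists_polynomial_norm_gradient_sq (hΔ : 1 ≤ Δ) (hf : IsPolyOfDegreeLE d Δ f)
    (x : EuclideanSpace ℝ (Fin d)) (n : ℕ) :
    ∃ q : Polynomial ℝ, q.natDegree ≤ 2 * ((Δ - 1) * Δ ^ n) ∧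
      ∀ η, ‖gradient f (gdIterate f η x n)‖ ^ 2 = q.eval η := by
  obtain ⟨p, hp, hfp⟩ := hf
  obtain rfl := funext hfp
  obtain ⟨X, hX, hX'⟩ := exists_polynomial_gdIterate hΔ hp x n
  refine ⟨∑ j, MvPolynomial.aeval X (MvPolynomial.pderiv j p) ^ 2, ?_, ?_⟩
  · refine Polynomial.natDegree_sum_le_of_forall_le _ _ fun j _ => ?_
    refine Polynomial.natDegree_pow_le.trans (Nat.mul_le_mul_left 2 ?_)
    exact MvPolynomial.aeval_natDegree_le _ ((totalDegree_pderiv_le p j).trans (by omega)) X hX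
  · intro η
    rw [EuclideanSpace.norm_sq_eq, Polynomial.eval_finsetSum]
    refine Finset.sum_congr rfl fun j _ => ?_
    rw [gradient_eval_mvPolynomial, Polynomial.eval_pow, Real.norm_eq_abs, sq_abs]
    congr 1
    simp only [hX', eval_aeval_polynomial]

lemma eval_neg_iff_of_no_root {r : Polynomial ℝ} {s t : ℝ} (hst : s ≤ t)
    (h : ∀ b, r.IsRoot b → r ≠ 0 → ¬ (s ≤ b ∧ b ≤ t)) : r.eval s < 0 ↔ r.eval t < 0 := by
  by_cases hr : r = 0
  · simp [hr]
  have hc : ContinuousOn (fun y => r.eval y) (Set.Icc s t) := r.continuous.continuousOn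
  constructor
  · intro h1
    by_contra! h2
    obtain ⟨b, hb, hb'⟩ := intermediate_value_Icc hst hc ⟨h1.le, h2⟩
    exact h b hb' hr hb
  · intro h1
    by_contra! h2
    obtain ⟨b, hb, hb'⟩ := intermediate_value_Icc' hst hc ⟨h1.le, h2⟩
    exact h b hb' hr hb

lemma sum_two_mul_pred_mul_pow (hΔ : 1 ≤ Δ) (H : ℕ) :
    ∑ n ∈ Finset.range H, 2 * ((Δ - 1) * Δ ^ n) ≤ 2 * Δ ^ H := by
  obtain ⟨e, rfl⟩ := Nat.exists_eq_add_of_le' hΔ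
  induction H with
  | zero => simp
  | succ H ih =>
    rw [Finset.sum_range_succ]
    refine (Nat.add_le_add_right ih _).trans (le_of_eq ?_)
    rw [pow_succ, Nat.add_sub_cancel]
    ring

/-- On one instance, the cost is constant between consecutive points of a set of at most
`2 Δ ^ H` step sizes: the roots of the polynomials `‖∇f(x_n)‖² - θ²` in the step size, whose
degrees are at most `2 (Δ - 1) Δ ^ n`. -/
lemma exists_breakpoints (hΔ : 1 ≤ Δ) (hf : IsPolyOfDegreeLE d Δ f) (H : ℕ) (θ : ℝ)
    (x : EuclideanSpace ℝ (Fin d)) :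
    ∃ B : Finset ℝ, B.card ≤ 2 * Δ ^ H ∧ ∀ s t, s ≤ t → (∀ b ∈ B, ¬ (s ≤ b ∧ b ≤ t)) →
      gdCost H θ s x f = gdCost H θ t x f := by
  classical
  choose q hq hq' using exists_polynomial_norm_gradient_sq hΔ hf x
  -- a polynomial that vanishes identically has no roots in Mathlib's sense and needs none
  refine ⟨(Finset.range H).biUnion fun n => (q n - Polynomial.C (θ ^ 2)).roots.toFinset, ?_, ?_⟩
  · refine Finset.card_biUnion_le.trans (le_trans ?_ (sum_two_mul_pred_mul_pow hΔ H))
    refine Finset.sum_le_sum fun n _ => ?_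
    refine (Multiset.toFinset_card_le _).trans ((Polynomial.card_roots' _).trans ?_)
    rw [Polynomial.natDegree_sub_C]
    exact hq n
  · intro s t hst hB
    rw [gdCost_eq_firstHit, gdCost_eq_firstHit]
    refine firstHit_congr fun n hn => ?_
    rcases le_or_gt θ 0 with hθ | hθ
    · constructor <;> intro h <;> exact absurd (h.trans_le hθ) (not_lt.2 (norm_nonneg _))
    have key : ∀ η, ‖gradient f (gdIterate f η x n)‖ < θ ↔
        (q n - Polynomial.C (θ ^ 2)).eval η < 0 := by
      intro η
      rw [Polynomial.eval_sub, Polynomial.eval_C, ← hq', sub_neg,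
        sq_lt_sq₀ (norm_nonneg _) hθ.le]
    rw [key, key]
    refine eval_neg_iff_of_no_root hst fun b hb hne => hB b ?_
    simp only [Finset.mem_biUnion, Finset.mem_range, Multiset.mem_toFinset]
    exact ⟨n, hn, (Polynomial.mem_roots hne).2 hb⟩

end Breakpoints

/-! ### Measurability of existential events -/

lemma IsSigmaCompact.measurableSet_of_t2 {Y : Type*} [TopologicalSpace Y] [T2Space Y]
    [MeasurableSpace Y] [OpensMeasurableSpace Y] {s : Set Y} (hs : IsSigmaCompact s) :
    MeasurableSet s := by
  obtain ⟨K, hK, rfl⟩ := hs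
  exact MeasurableSet.iUnion fun n => (hK n).measurableSet

/-- An event that asks for a real parameter at which finitely many strict inequalities between
continuous functions show a prescribed pattern is the projection of a σ-compact set, hence
measurable. -/
lemma measurableSet_exists_pattern {Y : Type*} [TopologicalSpace Y] [T2Space Y]
    [SigmaCompactSpace Y] [MeasurableSpace Y] [OpensMeasurableSpace Y] {ι : Type*} [Finite ι]
    (q : ι → Y × ℝ → ℝ) (hq : ∀ i, Continuous (q i)) (θ : ℝ) (Q : (ι → Prop) → Prop) :
    MeasurableSet {y | ∃ η, Q fun i => q i (y, η) < θ} := by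
  classical
  -- a strict inequality `q < θ` is the union over `j` of the closed conditions `q ≤ θ - 1 / (j + 1)`
  let K : (ι → Prop) → ℕ → Set (Y × ℝ) := fun β j =>
    ⋂ i, {z | (β i ∧ q i z ≤ θ - 1 / ((j : ℝ) + 1)) ∨ (¬ β i ∧ θ ≤ q i z)}
  have hK : ∀ β j, IsClosed (K β j) := by
    intro β j
    refine isClosed_iInter fun i => ?_
    by_cases h : β i
    · simpa [h] using isClosed_le (hq i) continuous_const
    · simpa [h] using isClosed_le continuous_const (hq i)
  have hset : {y | ∃ η, Q fun i => q i (y, η) < θ}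
      = ⋃ β : {β : ι → Prop // Q β}, ⋃ j : ℕ, Prod.fst '' K β.1 j := by
    ext y
    simp only [Set.mem_ofPred_eq, Set.mem_iUnion, Set.mem_image, Prod.exists, exists_and_right,
      exists_eq_right, K, Set.mem_iInter]
    constructor
    · rintro ⟨η, hη⟩
      have hev : ∀ i, ∀ᶠ j : ℕ in Filter.atTop, q i (y, η) < θ →
          q i (y, η) ≤ θ - 1 / ((j : ℝ) + 1) := by
        intro i
        by_cases h : q i (y, η) < θ
        · have := (tendsto_one_div_add_atTop_nhds_zero_nat (𝕜 := ℝ)).eventually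
            (gt_mem_nhds (sub_pos.2 h))
          filter_upwards [this] with j hj _
          linarith
        · exact Filter.Eventually.of_forall fun j h' => absurd h' h
      obtain ⟨j, hj⟩ := (Filter.eventually_all.2 hev).exists
      refine ⟨⟨_, hη⟩, j, η, fun i => ?_⟩
      by_cases h : q i (y, η) < θ
      · exact Or.inl ⟨h, hj i h⟩
      · exact Or.inr ⟨h, not_lt.1 h⟩
    · rintro ⟨⟨β, hβ⟩, j, η, h⟩
      refine ⟨η, ?_⟩
      have : (fun i => q i (y, η) < θ) = β := by
        funext i
        have hpos : 0 < 1 / ((j : ℝ) + 1) := by positivity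
        rcases h i with ⟨h1, h2⟩ | ⟨h1, h2⟩
        · exact propext ⟨fun _ => h1, fun _ => by linarith⟩
        · exact propext ⟨fun h3 => absurd h3 (not_lt.2 h2), fun h3 => absurd h3 h1⟩
      rw [this]
      exact hβ
  rw [hset]
  refine MeasurableSet.iUnion fun β => MeasurableSet.iUnion fun j => ?_
  exact ((isSigmaCompact_univ.of_isClosed_subset (hK _ _) (Set.subset_univ _)).image
    continuous_fst).measurableSet_of_t2

/-! ### Coordinates on polynomial instances -/

/-- A finite-dimensional space of functions has finitely many interpolation nodes. -/
lemma exists_interpolation {α : Type*} (V : Submodule ℝ (α → ℝ)) [FiniteDimensional ℝ V] :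
    ∃ (n : ℕ) (y : Fin n → α) (b : Fin n → α → ℝ), (∀ i, b i ∈ V) ∧
      ∀ f ∈ V, f = fun a => ∑ i, f (y i) * b i a := by
  classical
  -- the evaluations span the dual of `V`; a basis among them is dual to the interpolating functions
  let ev : α → Module.Dual ℝ V := fun a => (LinearMap.proj a).comp V.subtype
  have hspan : ⊤ ≤ Submodule.span ℝ (Set.range ev) := by
    by_contra h
    obtain ⟨φ, hφ, hφ'⟩ := Submodule.exists_le_ker_of_lt_top _ (lt_top_iff_ne_top.2
      fun h' => h h'.ge)
    apply hφ
    obtain ⟨v, rfl⟩ := (Module.evalEquiv ℝ V).surjective φ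
    have hv : v = 0 := by
      ext a
      have := hφ' (Submodule.subset_span ⟨a, rfl⟩)
      simpa [ev] using this
    rw [hv, map_zero]
  let B := (Module.Basis.ofSpan hspan)
  have : Fintype ((linearIndepOn_empty ℝ id).extend (Set.empty_subset (Set.range ev))) :=
    FiniteDimensional.fintypeBasisIndex B
  let B' := B.reindex (Fintype.equivFin _)
  have hB : ∀ i, ∃ a, ev a = B' i := by
    intro i
    have : B' i ∈ Set.range B := by simp [B']
    exact Module.Basis.ofSpan_subset hspan this
  choose y hy using hB
  let c : Fin _ → V := fun i => (Module.evalEquiv ℝ V).symm (B'.coord i)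
  refine ⟨_, y, fun i => (c i : α → ℝ), fun i => (c i).2, ?_⟩
  intro f hf
  funext a
  have h1 : ∀ φ : Module.Dual ℝ V, ∀ i, B'.repr φ i = φ (c i) := by
    intro φ i
    have := Module.apply_evalEquiv_symm_apply ℝ V φ (B'.coord i)
    rw [this, Module.Basis.coord_apply]
  have h2 := B'.sum_repr (ev a)
  have h3 := LinearMap.congr_fun h2 ⟨f, hf⟩
  simp only [h1, LinearMap.sum_apply, LinearMap.smul_apply, ← hy] at h3
  simp only [ev, LinearMap.comp_apply, Submodule.subtype_apply, LinearMap.proj_apply,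
    smul_eq_mul] at h3
  rw [← h3]
  exact Finset.sum_congr rfl fun i _ => mul_comm _ _

lemma exists_interpolation_polynomial (d Δ : ℕ) :
    ∃ (N : ℕ) (y : Fin N → EuclideanSpace ℝ (Fin d)) (p : Fin N → MvPolynomial (Fin d) ℝ),
      ∀ f, IsPolyOfDegreeLE d Δ f →
        f = fun x => ∑ i, f (y i) * MvPolynomial.eval (fun j => x j) (p i) := by
  let E : MvPolynomial (Fin d) ℝ →ₗ[ℝ] (EuclideanSpace ℝ (Fin d) → ℝ) :=
    { toFun := fun p x => MvPolynomial.eval (fun j => x j) p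
      map_add' := fun p q => by ext x; simp
      map_smul' := fun a p => by ext x; simp }
  obtain ⟨N, y, b, hb, h⟩ :=
    exists_interpolation ((MvPolynomial.restrictTotalDegree (Fin d) ℝ Δ).map E)
  choose p _ hp using hb
  refine ⟨N, y, p, fun f ⟨q, hq, hfq⟩ => ?_⟩
  have := h f ⟨q, (MvPolynomial.mem_restrictTotalDegree _ _ _).2 hq, (funext hfq).symm⟩
  simp only [← hp] at this
  exact this

section Coordinates

variable {d N : ℕ} (p : Fin N → MvPolynomial (Fin d) ℝ)

/-- The polynomial function with coordinates `e` with respect to the polynomials `p`. -/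
noncomputable def polyCombination (e : Fin N → ℝ) (x : EuclideanSpace ℝ (Fin d)) : ℝ :=
  ∑ i, e i * MvPolynomial.eval (fun j => x j) (p i)

lemma gradient_polyCombination (e : Fin N → ℝ) (x : EuclideanSpace ℝ (Fin d)) (j : Fin d) :
    gradient (polyCombination p e) x j =
      ∑ i, e i * MvPolynomial.eval (fun j => x j) (MvPolynomial.pderiv j (p i)) := by
  have h : polyCombination p e = fun x : EuclideanSpace ℝ (Fin d) =>
      MvPolynomial.eval (fun j => x j) (∑ i, MvPolynomial.C (e i) * p i) := by
    funext x
    simp [polyCombination]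
  rw [h, gradient_eval_mvPolynomial]
  simp [map_sum]

lemma continuous_gradient_polyCombination :
    Continuous fun z : EuclideanSpace ℝ (Fin d) × (Fin N → ℝ) =>
      gradient (polyCombination p z.2) z.1 := by
  have h : (fun z : EuclideanSpace ℝ (Fin d) × (Fin N → ℝ) =>
      gradient (polyCombination p z.2) z.1) = fun z => WithLp.toLp 2 fun j =>
        ∑ i, z.2 i * MvPolynomial.eval (fun j => z.1 j) (MvPolynomial.pderiv j (p i)) := by
    funext z
    ext j
    exact gradient_polyCombination p z.2 z.1 j
  rw [h]
  refine (PiLp.continuous_toLp 2 _).comp (continuous_pi fun j => ?_)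
  refine continuous_finsetSum _ fun i _ => Continuous.mul (by fun_prop) ?_
  exact (MvPolynomial.continuous_eval _).comp (by fun_prop)

lemma continuous_gdIterate_polyCombination (n : ℕ) :
    Continuous fun z : (EuclideanSpace ℝ (Fin d) × (Fin N → ℝ)) × ℝ =>
      gdIterate (polyCombination p z.1.2) z.2 z.1.1 n := by
  induction n with
  | zero => simp only [gdIterate]; fun_prop
  | succ n ih =>
    simp only [gdIterate]
    refine ih.sub (continuous_snd.smul ?_)
    exact (continuous_gradient_polyCombination p).comp
      (ih.prodMk (continuous_snd.comp continuous_fst))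

end Coordinates

/-- Polynomial instances have finitely many measurable coordinates, of which the gradient norms
along the iterates are continuous functions, jointly with the step size. -/
lemma exists_coordinates {d Δ : ℕ}
    (I : Set (EuclideanSpace ℝ (Fin d) × (EuclideanSpace ℝ (Fin d) → ℝ)))
    (hI : ∀ z ∈ I, IsPolyOfDegreeLE d Δ z.2) :
    ∃ (N : ℕ) (Φ : I → EuclideanSpace ℝ (Fin d) × (Fin N → ℝ))
      (g : ℕ → (EuclideanSpace ℝ (Fin d) × (Fin N → ℝ)) × ℝ → ℝ),
      Measurable Φ ∧ (∀ n, Continuous (g n)) ∧ ∀ (z : I) (η : ℝ) (n : ℕ),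
        ‖gradient z.1.2 (gdIterate z.1.2 η z.1.1 n)‖ = g n (Φ z, η) := by
  obtain ⟨N, y, p, h⟩ := exists_interpolation_polynomial d Δ
  refine ⟨N, fun z => (z.1.1, fun i => z.1.2 (y i)), fun n z =>
    ‖gradient (polyCombination p z.1.2) (gdIterate (polyCombination p z.1.2) z.2 z.1.1 n)‖,
    ?_, fun n => ?_, fun z η n => ?_⟩
  · refine Measurable.prodMk (measurable_fst.comp measurable_subtype_coe) ?_
    refine measurable_pi_lambda _ fun i => ?_
    exact (measurable_pi_apply (y i)).comp (measurable_snd.comp measurable_subtype_coe)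
  · exact ((continuous_gradient_polyCombination p).comp
      ((continuous_gdIterate_polyCombination p n).prodMk
        (continuous_snd.comp continuous_fst))).norm
  · have hz : z.1.2 = polyCombination p fun i => z.1.2 (y i) := h _ (hI z.1 z.2)
    simp only
    rw [← hz]

section Cost

variable {d Δ : ℕ} {I : Set (EuclideanSpace ℝ (Fin d) × (EuclideanSpace ℝ (Fin d) → ℝ))}

lemma measurable_gdCost (hI : ∀ z ∈ I, IsPolyOfDegreeLE d Δ z.2) (H : ℕ) (θ η : ℝ) :
    Measurable fun z : I => gdCost H θ η z.1.1 z.1.2 := by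
  obtain ⟨N, Φ, g, hΦ, hg, hgz⟩ := exists_coordinates I hI
  refine measurable_to_countable' fun c => ?_
  have h := (measurableSet_exists_pattern (fun (n : Fin H) z => g n (z.1, η))
    (fun n => (hg n).comp (by fun_prop)) θ
    (fun P => firstHit H (fun n => ∃ h : n < H, P ⟨n, h⟩) = c)).preimage hΦ
  convert h using 1
  ext z
  simp only [Set.mem_preimage, Set.mem_singleton_iff, Set.mem_ofPred_eq, exists_const,
    gdCost_eq_firstHit, hgz]
  rw [firstHit_congr]
  intro n hn
  simp [hn]

lemma measurableSet_exists_lt_abs_sum_gdCost (hI : ∀ z ∈ I, IsPolyOfDegreeLE d Δ z.2) (H : ℕ)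
    (θ τ : ℝ) (m : ℕ) :
    MeasurableSet {S : Fin m → I × I | ∃ η : ℝ,
      τ < |∑ k, ((gdCost H θ η (S k).1.1.1 (S k).1.1.2 : ℝ) -
        (gdCost H θ η (S k).2.1.1 (S k).2.1.2 : ℝ))|} := by
  obtain ⟨N, Φ, g, hΦ, hg, hgz⟩ := exists_coordinates I hI
  let Y := EuclideanSpace ℝ (Fin d) × (Fin N → ℝ)
  let q : (Fin m × Fin H) ⊕ (Fin m × Fin H) → (Fin m → Y × Y) × ℝ → ℝ := Sum.elim
    (fun i z => g i.2 ((z.1 i.1).1, z.2)) (fun i z => g i.2 ((z.1 i.1).2, z.2))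
  have hq : ∀ i, Continuous (q i) := by
    rintro (i | i)
    · exact (hg i.2).comp (by fun_prop)
    · exact (hg i.2).comp (by fun_prop)
  have hΨ : Measurable fun (S : Fin m → I × I) k => ((Φ (S k).1, Φ (S k).2) : Y × Y) := by
    refine measurable_pi_lambda _ fun k => ?_
    exact (hΦ.comp (measurable_fst.comp (measurable_pi_apply k))).prodMk
      (hΦ.comp (measurable_snd.comp (measurable_pi_apply k)))
  have h := (measurableSet_exists_pattern q hq θ (fun P => τ < |∑ k : Fin m,
    ((firstHit H (fun n => ∃ h : n < H, P (Sum.inl (k, ⟨n, h⟩))) : ℝ) -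
      (firstHit H (fun n => ∃ h : n < H, P (Sum.inr (k, ⟨n, h⟩))) : ℝ))|)).preimage hΨ
  convert h using 1
  ext S
  simp only [Set.mem_preimage, Set.mem_ofPred_eq, gdCost_eq_firstHit, hgz, q, Sum.elim_inl,
    Sum.elim_inr]
  refine exists_congr fun η => ?_
  have key : ∀ u : ℕ → ℝ, firstHit H (fun n => u n < θ) =
      firstHit H (fun n => ∃ _ : n < H, u n < θ) := fun u =>
    firstHit_congr fun n hn => by simp [hn]
  simp only [key]

end Cost

/-! ### Symmetrization -/

section Symmetrization

variable {X : Type*}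

/-- Exchange of the two halves of a double sample at the positions where `σ` is `false`. -/
def swapSample {m : ℕ} (σ : Fin m → Bool) (S : Fin m → X × X) : Fin m → X × X :=
  fun k => if σ k then S k else (S k).swap

lemma signedSum_swapSample {m : ℕ} (σ : Fin m → Bool) (S : Fin m → X × X) (ℓ : X → ℝ) :
    ∑ k, (ℓ (swapSample σ S k).1 - ℓ (swapSample σ S k).2)
      = signedSum σ fun k => ℓ (S k).1 - ℓ (S k).2 := by
  refine Finset.sum_congr rfl fun k _ => ?_
  cases h : σ k <;> simp [swapSample, boolSign, h]

variable [MeasurableSpace X] (D : Measure X) [IsProbabilityMeasure D]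

lemma measurePreserving_swapSample {m : ℕ} (σ : Fin m → Bool) :
    MeasurePreserving (swapSample (X := X) σ) (Measure.pi fun _ => D.prod D)
      (Measure.pi fun _ => D.prod D) := by
  refine measurePreserving_pi (fun _ => D.prod D) (fun _ => D.prod D)
    (f := fun k z => if σ k then z else z.swap) fun k => ?_
  cases σ k with
  | true => exact MeasurePreserving.id _
  | false => simpa using (Measure.measurePreserving_swap (μ := D) (ν := D))

/-- If for every double sample at most a fraction `p` of the swaps leads into an event, then the
event has probability at most `p`. -/
lemma measure_le_of_card_swapSample_le {m : ℕ} {F : Set (Fin m → X × X)} (hF : MeasurableSet F)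
    [∀ S : Fin m → X × X, DecidablePred fun σ => swapSample σ S ∈ F] {p : ℝ}
    (h : ∀ S, ((Finset.univ.filter fun σ : Fin m → Bool => swapSample σ S ∈ F).card : ℝ)
      ≤ 2 ^ m * p) :
    Measure.pi (fun _ : Fin m => D.prod D) F ≤ ENNReal.ofReal p := by
  set μ := Measure.pi (fun _ : Fin m => D.prod D) with hμ
  have h1 : ∀ σ : Fin m → Bool, ∫⁻ S, F.indicator 1 (swapSample σ S) ∂μ = μ F := by
    intro σ
    rw [← lintegral_indicator_one hF]
    exact (measurePreserving_swapSample D σ).lintegral_comp (measurable_one.indicator hF)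
  have h2 : (2 : ENNReal) ^ m * μ F
      = ∫⁻ S, ∑ σ : Fin m → Bool, F.indicator 1 (swapSample σ S) ∂μ := by
    rw [lintegral_finsetSum]
    · simp [h1]
    · intro σ _
      exact (measurable_one.indicator hF).comp (measurePreserving_swapSample D σ).measurable
  have h3 : ∀ S, ∑ σ : Fin m → Bool, F.indicator (1 : (Fin m → X × X) → ENNReal) (swapSample σ S)
      ≤ 2 ^ m * ENNReal.ofReal p := by
    intro S
    have h4 : ∑ σ : Fin m → Bool, F.indicator (1 : (Fin m → X × X) → ENNReal) (swapSample σ S)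
        = ((Finset.univ.filter fun σ : Fin m → Bool => swapSample σ S ∈ F).card : ENNReal) := by
      simp [Set.indicator_apply]
    rw [h4, ← ENNReal.ofReal_natCast]
    refine (ENNReal.ofReal_le_ofReal (h S)).trans (le_of_eq ?_)
    rw [ENNReal.ofReal_mul (by positivity), ENNReal.ofReal_pow (by norm_num)]
    simp
  have h5 : (2 : ENNReal) ^ m * μ F ≤ 2 ^ m * ENNReal.ofReal p := by
    rw [h2]
    refine (lintegral_mono h3).trans ?_
    simp [hμ]
  exact (ENNReal.mul_le_mul_iff_right (by positivity) (by finiteness)).1 h5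

/-- Chebyshev's inequality for an empirical sum, in the form that half of the samples are good. -/
lemma half_le_measure_abs_sum_sub_le {m : ℕ} (hm : 0 < m) {ℓ : X → ℝ} (hℓ : Measurable ℓ)
    {h : ℝ} (hb : ∀ x, ℓ x ∈ Set.Icc 0 h) {ε : ℝ} (hε : 0 < ε) (hmε : 2 * h ^ 2 ≤ m * ε ^ 2) :
    1 / 2 ≤ Measure.pi (fun _ : Fin m => D)
      {S | |∑ k, ℓ (S k) - m * ∫ z, ℓ z ∂D| < m * ε / 2} := by
  set μ := Measure.pi (fun _ : Fin m => D) with hμ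
  have hm' : (0 : ℝ) < m := by exact_mod_cast hm
  have hmem : MemLp ℓ 2 D :=
    memLp_of_bounded (Filter.Eventually.of_forall hb) hℓ.aestronglyMeasurable 2
  have hmemk : ∀ k : Fin m, MemLp (fun S : Fin m → X => ℓ (S k)) 2 μ := fun k =>
    hmem.comp_measurePreserving (measurePreserving_eval (fun _ : Fin m => D) k)
  have hsum : MemLp (∑ k : Fin m, fun S : Fin m → X => ℓ (S k)) 2 μ :=
    memLp_finsetSum' _ fun k _ => hmemk k
  have hint : ∫ S', (∑ k : Fin m, fun S : Fin m → X => ℓ (S k)) S' ∂μ = m * ∫ z, ℓ z ∂D := by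
    simp only [Finset.sum_apply]
    rw [integral_finsetSum _ fun k _ => (hmemk k).integrable (by norm_num)]
    have : ∀ k : Fin m, ∫ S : Fin m → X, ℓ (S k) ∂μ = ∫ z, ℓ z ∂D := fun k =>
      integral_comp_eval (μ := fun _ : Fin m => D) (i := k) hℓ.aestronglyMeasurable
    simp [this]
  have hvar : ProbabilityTheory.variance (∑ k : Fin m, fun S : Fin m → X => ℓ (S k)) μ
      ≤ m * (h / 2) ^ 2 := by
    rw [hμ, ProbabilityTheory.variance_sum_pi (X := fun _ : Fin m => ℓ) fun _ => hmem]
    have := ProbabilityTheory.variance_le_sq_of_bounded (Filter.Eventually.of_forall hb)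
      hℓ.aemeasurable (μ := D)
    rw [sub_zero] at this
    simpa using mul_le_mul_of_nonneg_left this hm'.le
  have hcheb := ProbabilityTheory.meas_ge_le_variance_div_sq hsum (c := m * ε / 2) (by positivity)
  rw [hint] at hcheb
  simp only [Finset.sum_apply] at hcheb
  have hle : ProbabilityTheory.variance (∑ k : Fin m, fun S : Fin m → X => ℓ (S k)) μ
      / (m * ε / 2) ^ 2 ≤ 1 / 2 := by
    rw [div_le_iff₀ (by positivity)]
    refine hvar.trans ?_
    nlinarith
  have hcompl : {S : Fin m → X | |∑ k, ℓ (S k) - m * ∫ z, ℓ z ∂D| < m * ε / 2}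
      = {S : Fin m → X | m * ε / 2 ≤ |∑ k, ℓ (S k) - m * ∫ z, ℓ z ∂D|}ᶜ := by
    ext S; simp
  have hmeas : MeasurableSet {S : Fin m → X | m * ε / 2 ≤ |∑ k, ℓ (S k) - m * ∫ z, ℓ z ∂D|} := by
    refine measurableSet_le measurable_const ?_
    exact ((Finset.measurable_sum _ fun k _ => hℓ.comp (measurable_pi_apply k)).sub_const _).abs
  rw [hcompl, prob_compl_eq_one_sub hmeas]
  have h2 : μ {S : Fin m → X | m * ε / 2 ≤ |∑ k, ℓ (S k) - m * ∫ z, ℓ z ∂D|} ≤ 1 / 2 := by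
    refine hcheb.trans ((ENNReal.ofReal_le_ofReal hle).trans (le_of_eq ?_))
    rw [ENNReal.ofReal_div_of_pos (by norm_num)]; simp
  calc (1 / 2 : ENNReal) = 1 - 1 / 2 := by simp
    _ ≤ _ := tsub_le_tsub_left h2 1

/-- Symmetrization: a uniform deviation of empirical means from the expectations is at most twice
as likely as a uniform deviation of half the size between two independent samples, and the latter
is controlled by random swaps. Only the event about the double sample has to be measurable; the
event about the sample itself is bounded in outer measure. -/
theorem measure_exists_lt_abs_mean_sub_le {T : Type*} {m : ℕ} (hm : 0 < m) {ℓ : T → X → ℝ}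
    (hℓ : ∀ t, Measurable (ℓ t)) {h : ℝ} (hb : ∀ t x, ℓ t x ∈ Set.Icc 0 h) {ε : ℝ} (hε : 0 < ε)
    (hmε : 2 * h ^ 2 ≤ m * ε ^ 2)
    (hF : MeasurableSet {S : Fin m → X × X |
      ∃ t, m * ε / 2 < |∑ k, (ℓ t (S k).1 - ℓ t (S k).2)|})
    [∀ S : Fin m → X × X, DecidablePred fun σ : Fin m → Bool =>
      ∃ t, m * ε / 2 < |signedSum σ fun k => ℓ t (S k).1 - ℓ t (S k).2|] {p : ℝ}
    (hcard : ∀ S : Fin m → X × X, ((Finset.univ.filter fun σ : Fin m → Bool =>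
      ∃ t, m * ε / 2 < |signedSum σ fun k => ℓ t (S k).1 - ℓ t (S k).2|).card : ℝ)
        ≤ 2 ^ m * p) :
    Measure.pi (fun _ : Fin m => D)
      {S | ∃ t, ε < |(1 / (m : ℝ)) * ∑ k, ℓ t (S k) - ∫ z, ℓ t z ∂D|}
      ≤ ENNReal.ofReal (2 * p) := by
  classical
  have hm' : (0 : ℝ) < m := by exact_mod_cast hm
  set F := {S : Fin m → X × X | ∃ t, m * ε / 2 < |∑ k, (ℓ t (S k).1 - ℓ t (S k).2)|} with hFdef
  set ν := Measure.pi (fun _ : Fin m => D) with hν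
  have h1 : Measure.pi (fun _ : Fin m => D.prod D) F ≤ ENNReal.ofReal p := by
    refine measure_le_of_card_swapSample_le D hF fun S => ?_
    convert hcard S using 4
    simp only [hFdef, Set.mem_ofPred_eq, signedSum_swapSample]
  let e := MeasurableEquiv.arrowProdEquivProdArrow X X (Fin m)
  have he : MeasurePreserving e (Measure.pi fun _ : Fin m => D.prod D) (ν.prod ν) :=
    measurePreserving_arrowProdEquivProdArrow X X (Fin m) (fun _ => D) (fun _ => D)
  have hF' : MeasurableSet (e.symm ⁻¹' F) := e.symm.measurable hF
  have h2 : (ν.prod ν) (e.symm ⁻¹' F) ≤ ENNReal.ofReal p := by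
    rw [(he.symm e).measure_preimage_equiv]
    exact h1
  rw [Measure.prod_apply hF'] at h2
  have h3 := mul_meas_ge_le_lintegral (μ := ν) (measurable_measure_prodMk_left (ν := ν) hF') (1 / 2)
  have h4 : {S | ∃ t, ε < |(1 / (m : ℝ)) * ∑ k, ℓ t (S k) - ∫ z, ℓ t z ∂D|}
      ⊆ {S | 1 / 2 ≤ ν (Prod.mk S ⁻¹' (e.symm ⁻¹' F))} := by
    rintro S ⟨t, ht⟩
    refine (half_le_measure_abs_sum_sub_le D hm (hℓ t) (hb t) hε hmε).trans (measure_mono ?_)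
    intro S' hS'
    refine ⟨t, ?_⟩
    simp only [Set.mem_ofPred_eq] at hS'
    have h5 : m * ε < |∑ k, ℓ t (S k) - m * ∫ z, ℓ t z ∂D| := by
      have h6 : ∑ k, ℓ t (S k) - m * ∫ z, ℓ t z ∂D
          = m * ((1 / (m : ℝ)) * ∑ k, ℓ t (S k) - ∫ z, ℓ t z ∂D) := by field_simp
      rw [h6, abs_mul, abs_of_pos hm']
      gcongr
    change m * ε / 2 < |∑ k, (ℓ t (S k) - ℓ t (S' k))|
    rw [Finset.sum_sub_distrib]
    have h7 := abs_sub_abs_le_abs_sub (∑ k, ℓ t (S k) - m * ∫ z, ℓ t z ∂D)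
      (∑ k, ℓ t (S' k) - m * ∫ z, ℓ t z ∂D)
    rw [sub_sub_sub_cancel_right] at h7
    linarith
  have h8 : (1 / 2 : ENNReal) * ν {S | ∃ t, ε < |(1 / (m : ℝ)) * ∑ k, ℓ t (S k) -
      ∫ z, ℓ t z ∂D|} ≤ ENNReal.ofReal p :=
    (mul_le_mul_right (measure_mono h4) _).trans (h3.trans h2)
  rw [ENNReal.ofReal_mul (by norm_num), ENNReal.ofReal_ofNat]
  calc ν {S | ∃ t, ε < |(1 / (m : ℝ)) * ∑ k, ℓ t (S k) - ∫ z, ℓ t z ∂D|}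
      = 2 * ((1 / 2) * ν {S | ∃ t, ε < |(1 / (m : ℝ)) * ∑ k, ℓ t (S k) - ∫ z, ℓ t z ∂D|}) := by
        rw [← mul_assoc, one_div 2, ENNReal.mul_inv_cancel (by norm_num) (by norm_num), one_mul]
    _ ≤ 2 * ENNReal.ofReal p := by gcongr

end Symmetrization

/-! ### The clock of a family of breakpoints -/

/-- The number of points of `B` before `η`, where a point counts once when it is reached and once
more when it has been passed. Thus every passage through, to, or away from a point of `B`
increases the clock. -/
noncomputable def breakpointClock (B : Finset ℝ) (η : ℝ) : ℕ :=
  (B.filter (· < η)).card + (B.filter (· ≤ η)).card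

lemma breakpointClock_le (B : Finset ℝ) (η : ℝ) : breakpointClock B η ≤ 2 * B.card := by
  have h1 := Finset.card_filter_le B (· < η)
  have h2 := Finset.card_filter_le B (· ≤ η)
  unfold breakpointClock
  omega

lemma breakpointClock_mono (B : Finset ℝ) : Monotone (breakpointClock B) := by
  intro s t hst
  refine Nat.add_le_add (Finset.card_le_card fun b hb => ?_) (Finset.card_le_card fun b hb => ?_)
  · rw [Finset.mem_filter] at hb ⊢
    exact ⟨hb.1, hb.2.trans_le hst⟩
  · rw [Finset.mem_filter] at hb ⊢
    exact ⟨hb.1, hb.2.trans hst⟩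

lemma breakpointClock_lt {B : Finset ℝ} {b s t : ℝ} (hb : b ∈ B) (hsb : s ≤ b) (hbt : b ≤ t)
    (hst : s < t) : breakpointClock B s < breakpointClock B t := by
  have hsub1 : B.filter (· < s) ⊆ B.filter (· < t) := fun c hc => by
    rw [Finset.mem_filter] at hc ⊢
    exact ⟨hc.1, hc.2.trans hst⟩
  have hsub2 : B.filter (· ≤ s) ⊆ B.filter (· ≤ t) := fun c hc => by
    rw [Finset.mem_filter] at hc ⊢
    exact ⟨hc.1, hc.2.trans hst.le⟩
  rcases hsb.eq_or_lt with rfl | hsb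
  · refine Nat.add_lt_add_of_lt_of_le (Finset.card_lt_card ?_) (Finset.card_le_card hsub2)
    refine Finset.ssubset_iff_subset_ne.2 ⟨hsub1, fun h => ?_⟩
    have : s ∈ B.filter (· < s) := h ▸ Finset.mem_filter.2 ⟨hb, hst⟩
    exact lt_irrefl _ (Finset.mem_filter.1 this).2
  · refine Nat.add_lt_add_of_le_of_lt (Finset.card_le_card hsub1) (Finset.card_lt_card ?_)
    refine Finset.ssubset_iff_subset_ne.2 ⟨hsub2, fun h => ?_⟩
    have : b ∈ B.filter (· ≤ s) := h ▸ Finset.mem_filter.2 ⟨hb, hbt⟩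
    exact absurd (Finset.mem_filter.1 this).2 (not_le.2 hsb)

/-- For cost functions in `[0, h]` that depend on a real parameter and change only at `K`
breakpoints per instance, the symmetrized deviation on a fixed double sample has a Gaussian tail,
uniformly in the parameter. -/
lemma card_exists_lt_abs_signedSum_le_of_breakpoints {X : Type*} {ℓ : ℝ → X → ℝ} {h : ℝ}
    (hh : 0 < h) (hb : ∀ t x, ℓ t x ∈ Set.Icc 0 h) {K : ℕ} (hK : 1 ≤ K)
    (hbreak : ∀ x, ∃ B : Finset ℝ, B.card ≤ K ∧ ∀ s t, s ≤ t →
      (∀ b ∈ B, ¬ (s ≤ b ∧ b ≤ t)) → ℓ s x = ℓ t x)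
    {m : ℕ} (hm : 0 < m) {τ : ℝ} (hτ : 0 ≤ τ) (hu : 512 * Real.log 4 ≤ τ ^ 2 / (4 * h ^ 2 * m))
    (S : Fin m → X × X) [DecidablePred fun σ : Fin m → Bool =>
      ∃ t, τ < |signedSum σ fun k => ℓ t (S k).1 - ℓ t (S k).2|] :
    ((Finset.univ.filter fun σ : Fin m → Bool =>
      ∃ t, τ < |signedSum σ fun k => ℓ t (S k).1 - ℓ t (S k).2|).card : ℝ)
      ≤ 2 ^ m * (36 * K * Real.exp (-(τ ^ 2 / (4 * h ^ 2 * m) / 64))) := by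
  choose B hBcard hB using hbreak
  have hcongr : ∀ {x : X} {s t : ℝ}, s ≤ t →
      breakpointClock (B x) s = breakpointClock (B x) t → ℓ s x = ℓ t x := by
    intro x s t hst hclock
    rcases hst.eq_or_lt with rfl | hst'
    · rfl
    refine hB x s t hst fun b hbB hbst => ?_
    exact (breakpointClock_lt hbB hbst.1 hbst.2 hst').ne hclock
  let c : Fin m → ℝ → ℕ := fun k t =>
    breakpointClock (B (S k).1) t + breakpointClock (B (S k).2) t
  have hcmono : ∀ k, Monotone (c k) := fun k =>
    (breakpointClock_mono _).add (breakpointClock_mono _)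
  -- each coordinate moves by at most `2 h`, and only when its own clock advances
  have hk : ∀ k s t, s ≤ t → (ℓ s (S k).1 - ℓ s (S k).2 - (ℓ t (S k).1 - ℓ t (S k).2)) ^ 2
      ≤ 4 * h ^ 2 * ((c k t : ℝ) - c k s) := by
    intro k s t hst
    have h1 := breakpointClock_mono (B (S k).1) hst
    have h2 := breakpointClock_mono (B (S k).2) hst
    by_cases hc : c k s = c k t
    · have h3 : breakpointClock (B (S k).1) s = breakpointClock (B (S k).1) t := by
        simp only [c] at hc; omega
      have h4 : breakpointClock (B (S k).2) s = breakpointClock (B (S k).2) t := by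
        simp only [c] at hc; omega
      rw [hcongr hst h3, hcongr hst h4, hc]
      simp
    · have h3 : c k s + 1 ≤ c k t := Nat.succ_le_of_lt (lt_of_le_of_ne (hcmono k hst) hc)
      have h4 : (1 : ℝ) ≤ (c k t : ℝ) - c k s := by
        have : (c k s : ℝ) + 1 ≤ c k t := by exact_mod_cast h3
        linarith
      have h5 : (ℓ s (S k).1 - ℓ s (S k).2 - (ℓ t (S k).1 - ℓ t (S k).2)) ^ 2 ≤ (2 * h) ^ 2 := by
        obtain ⟨a1, a2⟩ := hb s (S k).1
        obtain ⟨b1, b2⟩ := hb s (S k).2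
        obtain ⟨c1, c2⟩ := hb t (S k).1
        obtain ⟨d1, d2⟩ := hb t (S k).2
        exact sq_le_sq' (by linarith) (by linarith)
      nlinarith [sq_nonneg h]
  have hle : ∀ s t, s ≤ t →
      ∑ k, (ℓ s (S k).1 - ℓ s (S k).2 - (ℓ t (S k).1 - ℓ t (S k).2)) ^ 2
        ≤ 4 * h ^ 2 * |((∑ k, c k s : ℕ) : ℝ) - (∑ k, c k t : ℕ)| := by
    intro s t hst
    refine (Finset.sum_le_sum fun k _ => hk k s t hst).trans ?_
    rw [← Finset.mul_sum, Finset.sum_sub_distrib, abs_sub_comm]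
    push_cast
    gcongr
    exact le_abs_self _
  refine card_exists_lt_abs_signedSum_le (fun t => ∑ k, c k t) hm
    (fun t k => ℓ t (S k).1 - ℓ t (S k).2) hK ?_ (by positivity) ?_ ?_ hτ hu
  · intro t
    have : ∀ k ∈ Finset.univ, c k t ≤ 4 * K := by
      intro k _
      have h1 := breakpointClock_le (B (S k).1) t
      have h2 := breakpointClock_le (B (S k).2) t
      have h3 := hBcard (S k).1
      have h4 := hBcard (S k).2
      simp only [c]
      omega
    refine (Finset.sum_le_card_nsmul _ _ _ this).trans (le_of_eq ?_)
    simp; ring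
  · intro s t
    rcases le_total s t with hst | hst
    · exact hle s t hst
    · rw [abs_sub_comm]
      refine le_trans (le_of_eq (Finset.sum_congr rfl fun k _ => ?_)) (hle t s hst)
      ring
  · intro t
    have : ∀ k ∈ Finset.univ, (ℓ t (S k).1 - ℓ t (S k).2) ^ 2 ≤ 4 * h ^ 2 := by
      intro k _
      obtain ⟨a1, a2⟩ := hb t (S k).1
      obtain ⟨b1, b2⟩ := hb t (S k).2
      have : (ℓ t (S k).1 - ℓ t (S k).2) ^ 2 ≤ (2 * h) ^ 2 :=
        sq_le_sq' (by linarith) (by linarith)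
      linarith
    refine (Finset.sum_le_card_nsmul _ _ _ this).trans (le_of_eq ?_)
    simp; ring

/-! ### Sample complexity -/

/-- The rate dominates the absolute constants of the bound. This fails for `Δ = 1` and `δ` close
to `1`, which the last hypothesis excludes. -/
lemma log_two_le_rate {Δ H : ℕ} {δ : ℝ} (hΔ : 1 ≤ Δ) (hH : 1 ≤ H) (hδ : 0 < δ) (hδ' : δ < 1)
    (hedge : 2 ≤ Δ ∨ δ ≤ 1 / 2) :
    Real.log 2 ≤ (H : ℝ) * Real.log Δ + Real.log (1 / δ) := by
  have hH' : (1 : ℝ) ≤ H := by exact_mod_cast hH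
  have hΔ' : (1 : ℝ) ≤ Δ := by exact_mod_cast hΔ
  have h1 : 0 ≤ Real.log Δ := Real.log_nonneg hΔ'
  have h2 : 0 ≤ Real.log (1 / δ) := Real.log_nonneg (by rw [le_div_iff₀ hδ]; linarith)
  rcases hedge with h | h
  · have h3 : Real.log 2 ≤ Real.log Δ :=
      Real.log_le_log (by norm_num) (by exact_mod_cast h)
    nlinarith
  · have h3 : Real.log 2 ≤ Real.log (1 / δ) :=
      Real.log_le_log (by norm_num) (by rw [le_div_iff₀ hδ]; linarith)
    have : 0 ≤ (H : ℝ) * Real.log Δ := by positivity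
    linarith

/-- The exponent `16` times the rate pays once for `Δ ^ H / δ` and, through `15 log 2`, for the
absolute factor `144`. -/
lemma failure_probability_le {Δ H : ℕ} {δ x : ℝ} (hΔ : 1 ≤ Δ) (hδ : 0 < δ)
    (hlog : Real.log 2 ≤ (H : ℝ) * Real.log Δ + Real.log (1 / δ))
    (hx : 1024 * ((H : ℝ) * Real.log Δ + Real.log (1 / δ)) ≤ x) :
    2 * (36 * ((2 * Δ ^ H : ℕ) : ℝ) * Real.exp (-(x / 64))) ≤ δ := by
  have hΔ' : (0 : ℝ) < Δ := by exact_mod_cast hΔ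
  have hle : -(x / 64) ≤
      -((15 : ℕ) * Real.log 2) + (-((H : ℝ) * Real.log Δ) + Real.log δ) := by
    rw [one_div, Real.log_inv] at *
    push_cast
    linarith
  have hexp : Real.exp (-(x / 64)) ≤ 1 / 2 ^ 15 * (1 / (Δ : ℝ) ^ H * δ) := by
    refine (Real.exp_le_exp.2 hle).trans (le_of_eq ?_)
    rw [Real.exp_add, Real.exp_add, Real.exp_neg, Real.exp_neg, Real.exp_nat_mul,
      Real.exp_nat_mul, Real.exp_log hδ, Real.exp_log hΔ', Real.exp_log two_pos, one_div, one_div]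
  calc 2 * (36 * ((2 * Δ ^ H : ℕ) : ℝ) * Real.exp (-(x / 64)))
      ≤ 2 * (36 * ((2 * Δ ^ H : ℕ) : ℝ) * (1 / 2 ^ 15 * (1 / (Δ : ℝ) ^ H * δ))) := by gcongr
    _ = 144 / 2 ^ 15 * δ := by push_cast; field_simp; ring
    _ ≤ δ := by linarith

/-- The instance space `I` carries the σ-algebra induced from `ℝ^d × (ℝ^d → ℝ)`, with the Borel
σ-algebra on `ℝ^d` and the one generated by the evaluations `f ↦ f y` on functions; on polynomials
of bounded degree the latter is the Borel σ-algebra of the space of coefficients. -/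
theorem mainTheorem2 :
    ∃ C : ℝ, 0 < C ∧
      ∀ (d Δ H : ℕ) (θ : ℝ) (_hΔ : 1 ≤ Δ)
        (I : Set (EuclideanSpace ℝ (Fin d) × (EuclideanSpace ℝ (Fin d) → ℝ)))
        (_hI : ∀ z ∈ I, IsPolyOfDegreeLE d Δ z.2)
        (P : Set ℝ) (_hP : P ⊆ Set.Ici 0)
        (D : Measure I) [IsProbabilityMeasure D]
        (ε δ : ℝ) (_hε : 0 < ε) (_hδ : 0 < δ) (_hδ' : δ < 1) (_hedge : 2 ≤ Δ ∨ δ ≤ 1 / 2)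
        (m : ℕ) (_hm : C * ((H : ℝ) ^ 2 / ε ^ 2 *
          ((H : ℝ) * Real.log (Δ : ℝ) + Real.log (1 / δ))) ≤ (m : ℝ)),
        UniformConvergence D (gdCostClass H θ I P) ε δ m := by
  -- `16384 = 16 * 1024`: the chaining exponent is `m ε ^ 2 / (16 H ^ 2)`, and it has to exceed
  -- `1024` times the rate
  refine ⟨16384, by norm_num, ?_⟩
  intro d Δ H θ hΔ I hI P _ D _ ε δ hε hδ hδ' hedge m hm
  have hbound : ∀ (η : ℝ) (z : I), (gdCost H θ η z.1.1 z.1.2 : ℝ) ∈ Set.Icc (0 : ℝ) H :=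
    fun η z => ⟨Nat.cast_nonneg _, by exact_mod_cast firstHit_le H _⟩
  have hmeas : ∀ η, Measurable fun z : I => (gdCost H θ η z.1.1 z.1.2 : ℝ) := fun η =>
    (measurable_from_top (f := fun n : ℕ => (n : ℝ))).comp (measurable_gdCost hI H θ η)
  refine ⟨?_, ?_⟩
  · rintro ℓ ⟨η, -, rfl⟩
    exact Integrable.of_mem_Icc 0 H (hmeas η).aemeasurable
      (Filter.Eventually.of_forall (hbound η))
  -- the failure event grows when all real step sizes are admitted
  have hsub : {S : Fin m → I | ¬ ∀ ℓ ∈ gdCostClass H θ I P,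
      |(1 / (m : ℝ)) * ∑ k, ℓ (S k) - ∫ z, ℓ z ∂D| ≤ ε} ⊆
      {S | ∃ η : ℝ, ε < |(1 / (m : ℝ)) * ∑ k, (gdCost H θ η (S k).1.1 (S k).1.2 : ℝ) -
        ∫ z : I, (gdCost H θ η z.1.1 z.1.2 : ℝ) ∂D|} := by
    intro S hS
    simp only [Set.mem_ofPred_eq, not_forall, not_le] at hS
    obtain ⟨ℓ, ⟨η, -, rfl⟩, hη⟩ := hS
    exact ⟨η, hη⟩
  refine (measure_mono hsub).trans ?_
  rcases Nat.eq_zero_or_pos H with rfl | hH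
  · -- with no iterations all costs vanish
    have hzero : ∀ (η : ℝ) (z : I), gdCost 0 θ η z.1.1 z.1.2 = 0 := fun η z =>
      Nat.le_zero.1 (firstHit_le 0 _)
    simp [hzero, not_lt.2 hε.le]
  have hH' : (0 : ℝ) < H := by exact_mod_cast hH
  have hlog := log_two_le_rate hΔ hH hδ hδ' hedge
  set rate := (H : ℝ) * Real.log Δ + Real.log (1 / δ) with hrate
  have hlog2 : (1 : ℝ) / 2 < Real.log 2 := by linarith [Real.log_two_gt_d9]
  have hmε : 16384 * ((H : ℝ) ^ 2 * rate) ≤ m * ε ^ 2 := by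
    have h1 : 16384 * ((H : ℝ) ^ 2 / ε ^ 2 * rate) = 16384 * ((H : ℝ) ^ 2 * rate) / ε ^ 2 := by
      ring
    rwa [h1, div_le_iff₀ (by positivity)] at hm
  have hm0 : 0 < m := by
    rcases Nat.eq_zero_or_pos m with rfl | h
    · exfalso
      have : 0 < (H : ℝ) ^ 2 * rate := mul_pos (by positivity) (by linarith)
      rw [Nat.cast_zero, zero_mul] at hmε
      linarith
    · exact h
  have hm' : (0 : ℝ) < m := by exact_mod_cast hm0
  have hx : 1024 * rate ≤ (m * ε / 2) ^ 2 / (4 * (H : ℝ) ^ 2 * m) := by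
    rw [le_div_iff₀ (by positivity)]
    nlinarith
  have hlog4 : Real.log 4 = 2 * Real.log 2 := by
    rw [show (4 : ℝ) = 2 ^ 2 by norm_num, Real.log_pow]; norm_num
  classical
  refine (measure_exists_lt_abs_mean_sub_le D hm0 hmeas hbound hε ?_
    (measurableSet_exists_lt_abs_sum_gdCost hI H θ _ m)
    (p := 36 * ((2 * Δ ^ H : ℕ) : ℝ) *
      Real.exp (-((m * ε / 2) ^ 2 / (4 * (H : ℝ) ^ 2 * m) / 64)))
    fun S => ?_).trans (ENNReal.ofReal_le_ofReal (failure_probability_le hΔ hδ hlog hx))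
  · -- the sample is large enough for Chebyshev's inequality
    have : (H : ℝ) ^ 2 * (1 / 2) ≤ (H : ℝ) ^ 2 * rate := by gcongr; linarith
    nlinarith [sq_nonneg (H : ℝ)]
  · refine card_exists_lt_abs_signedSum_le_of_breakpoints hH' hbound
      (Nat.one_le_iff_ne_zero.2 (by positivity)) (fun z => ?_) hm0 (by positivity)
      (by linarith) S
    obtain ⟨B, hB, hB'⟩ := exists_breakpoints hΔ (hI z.1 z.2) H θ z.1.1
    exact ⟨B, hB, fun s t hst h => by rw [hB' s t hst h]⟩
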